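/- Let $d\ge 2$ be an integer and let $S^d=\{x\in\mathbb{R}^{d+1}:|x|=1\}$. A \emph{filter} is a continuous function $g:[0,\infty)\to[0,\infty)$ with support contained in $[0,2]$. For $\ell\in\mathbb{N}_0$ let $Z(d,\ell)=(2\ell+d-1)\frac{\Gamma(\ell+d-1)}{\Gamma(d)\Gamma(\ell+1)}$ be the dimension of the space of spherical harmonics of exact degree $\ell$ on $S^d$, and let $P_\ell^{(d+1)}(t)=P_\ell^{(\frac{d-2}{2},\frac{d-2}{2})}(t)/P_\ell^{(\frac{d-2}{2},\frac{d-2}{2})}(1)$ be the normalised Gegenbauer polynomial, where $P_\ell^{(\alpha,\beta)}$ is the Jacobi polynomial of degree $\ell$. For $T\ge 0$ the filtered kernel $v_{T,g}$ is defined, for $t\in[-1,1]$, by \[ v_{T,g}(t)=\begin{cases}1,&0\le T<1,\\ \sum_{\ell=0}^{\infty} g\left(\frac{\ell}{T}\right) Z(d,\ell)\,P_\ell^{(d+1)}(t),&T\ge 1.\end{cases} \] Let $\kappa\ge 1$ be an integer, and let $g$ be a filter which is $\kappa$ times continuously differentiable on $[0,\infty)$ and constant on $[0,a]$ for some $0<a<2$.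 Then there is a constant $c$, depending only on $d$, $g$ and $\kappa$, such that for all $T\ge 1$, all $x,y\in S^d$ and $\theta\in[0,\pi]$ with $\cos\theta=x\cdot y$, \[ |v_{T,g}(\cos\theta)|\le \frac{c\,T^d}{(1+T\theta)^{\kappa}}. \] -/

import Mathlib

noncomputable section

namespace SphericalFilter

/-- The Jacobi polynomial `P_n^{(α,β)}` (in the standard normalisation
`P_n^{(α,β)}(1) = binom (n+α) n`), through its expansion at `1`:
`P_n^{(α,β)}(x) = (1/n!) ∑_{k=0}^n (n choose k) (n+α+β+1)_k (α+k+1)_{n-k} ((x-1)/2)^k`,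
where `(a)_k = a (a+1) ⋯ (a+k-1)` is the rising factorial. -/
def jacobi (α β : ℝ) (n : ℕ) : Polynomial ℝ :=
  ∑ k ∈ Finset.range (n + 1),
    Polynomial.C ((n.choose k : ℝ) * (ascPochhammer ℝ k).eval (n + α + β + 1)
        * (ascPochhammer ℝ (n - k)).eval (α + k + 1) / (n.factorial : ℝ))
      * (Polynomial.C (1 / 2 : ℝ) * (Polynomial.X - 1)) ^ k

/-- The normalised Legendre (Gegenbauer) polynomial
`P_ℓ^{(d+1)}(t) = P_ℓ^{((d-2)/2,(d-2)/2)}(t) / P_ℓ^{((d-2)/2,(d-2)/2)}(1)`. -/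
def normGegenbauer (d ℓ : ℕ) (t : ℝ) : ℝ :=
  (jacobi (((d : ℝ) - 2) / 2) (((d : ℝ) - 2) / 2) ℓ).eval t
    / (jacobi (((d : ℝ) - 2) / 2) (((d : ℝ) - 2) / 2) ℓ).eval 1

/-- The dimension `Z(d,ℓ)` of the space of spherical harmonics of exact degree `ℓ` on the
sphere `S^d`: `Z(d,ℓ) = (2ℓ+d-1) Γ(ℓ+d-1) / (Γ(d) Γ(ℓ+1))`. -/
def harmonicDim (d ℓ : ℕ) : ℝ :=
  (2 * (ℓ : ℝ) + d - 1) * Real.Gamma ((ℓ : ℝ) + d - 1)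
    / (Real.Gamma (d : ℝ) * Real.Gamma ((ℓ : ℝ) + 1))

/-- A filter is a continuous function `[0,∞) → [0,∞)` with support contained in `[0,2]`.
It is represented by a function on `ℝ` of which only the values on `[0,∞)` matter. -/
structure IsFilter (g : ℝ → ℝ) : Prop where
  continuousOn : ContinuousOn g (Set.Ici 0)
  nonneg : ∀ t, 0 ≤ t → 0 ≤ g t
  eq_zero : ∀ t, 2 < t → g t = 0

/-- The filtered kernel `v_{T,g}` on `S^d`, as a function of `t = x · y`, for `T ≥ 0`. For a
filter `g` and `T ≥ 1` the series has only finitely many nonzero terms. -/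
def filteredKernel (d : ℕ) (g : ℝ → ℝ) (T t : ℝ) : ℝ :=
  if T < 1 then 1
  else ∑' ℓ : ℕ, g ((ℓ : ℝ) / T) * harmonicDim d ℓ * normGegenbauer d ℓ t

end SphericalFilter

end

/-! Multiplication by `1 - t` acts on Gegenbauer expansions as a second-order difference operator on
the coefficients. Write `Z_n`, `P_n`, `w_n` for `harmonicDim d n`, `normGegenbauer d n t`,
`darbouxWeight d n`. The three-term recurrence takes the symmetric form `t Z_n P_n = w_n P_{n+1} +
w_{n-1} P_{n-1}`, so summation by parts moves `1 - t` onto the coefficients as `diffOp`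
(`gegenbauerSeries_diffOp`).

For the samples `g(n/T)`, each application of `diffOp` gains `T⁻²` where `n ≳ T`
(`SymbolBounded.diffOp`). For smaller `n` and large `T` the samples are locally constant, so
`diffOp` annihilates them. After `m` steps the coefficients are `O(T^{-2m})` on `O(T)` indices,
where `Z_n = O(T^{d-1})` and `|P_n| ≤ 1`. Hence `(1 - cos θ)^m |v| ≤ C T^{d-2m}`, and `1 - cos θ ≳
θ²` settles `κ = 2m`.

For `κ = 2m + 1` only one more difference is available. A single summation by parts
(`sum_one_sub_mul`) puts one difference on the coefficients and one on the polynomials, and `|P_n -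
P_{n+1}| ≤ 3θ` supplies the missing factor. Both bounds on `P_n` come from a quadratic form that
decreases along the recurrence (`gegenbauer_energy_le`). -/

namespace SphericalFilter

/-! ### Gegenbauer polynomials: coefficients and recurrence -/

open Finset

/-- The coefficient of `((t - 1) / 2) ^ k` in the normalised Gegenbauer polynomial. -/
noncomputable def gegenbauerCoeff (d n k : ℕ) : ℝ :=
  (n.choose k : ℝ) * (ascPochhammer ℝ k).eval ((n : ℝ) + d - 1)
    / (ascPochhammer ℝ k).eval ((d : ℝ) / 2)

/-- At `t = 1` only `k = 0` survives, giving `(d/2)_n / n!`. The splitting `(d/2)_n = (d/2)_k (d/2 +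
k)_{n-k}` then cancels the second Pochhammer factor. -/
theorem normGegenbauer_eq_sum {d : ℕ} (hd : 2 ≤ d) (n : ℕ) (t : ℝ) :
    normGegenbauer d n t =
      ∑ k ∈ range (n + 1), gegenbauerCoeff d n k * ((t - 1) / 2) ^ k := by
  have hd' : (0 : ℝ) < (d : ℝ) / 2 := by
    have : (2 : ℝ) ≤ d := by exact_mod_cast hd
    linarith
  have hα : ((d : ℝ) - 2) / 2 + 1 = (d : ℝ) / 2 := by ring
  have hone : (jacobi (((d : ℝ) - 2) / 2) (((d : ℝ) - 2) / 2) n).eval 1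
      = (ascPochhammer ℝ n).eval ((d : ℝ) / 2) / (n.factorial : ℝ) := by
    rw [jacobi, Polynomial.eval_finsetSum, sum_eq_single 0]
    · simp [hα]
    · intro k _ hk
      simp [hk]
    · simp
  have hpos : ∀ k, 0 < (ascPochhammer ℝ k).eval ((d : ℝ) / 2) :=
    fun k => ascPochhammer_pos k _ hd'
  have hfac : (n.factorial : ℝ) ≠ 0 := by exact_mod_cast n.factorial_ne_zero
  rw [normGegenbauer, hone, jacobi, Polynomial.eval_finsetSum, sum_div]
  refine sum_congr rfl fun k hk => ?_
  have hkn : k ≤ n := by simpa [Nat.lt_succ_iff] using hk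
  have hmul : (ascPochhammer ℝ n).eval ((d : ℝ) / 2) =
      (ascPochhammer ℝ k).eval ((d : ℝ) / 2)
        * (ascPochhammer ℝ (n - k)).eval (((d : ℝ) - 2) / 2 + k + 1) := by
    have h := congrArg (Polynomial.eval ((d : ℝ) / 2)) (ascPochhammer_mul ℝ k (n - k))
    rw [Nat.add_sub_cancel' hkn] at h
    rw [← h]
    simp only [Polynomial.eval_mul, Polynomial.eval_comp, Polynomial.eval_add,
      Polynomial.eval_X, Polynomial.eval_natCast]
    congr 2
    ring
  have h1 := (hpos n).ne'
  have h2 := (hpos k).ne'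
  have harg : (n : ℝ) + ((d : ℝ) - 2) / 2 + ((d : ℝ) - 2) / 2 + 1 = (n : ℝ) + d - 1 := by ring
  simp only [Polynomial.eval_mul, Polynomial.eval_C, Polynomial.eval_pow, Polynomial.eval_sub,
    Polynomial.eval_X, Polynomial.eval_one, harg, gegenbauerCoeff]
  have h3 : (ascPochhammer ℝ (n - k)).eval (((d : ℝ) - 2) / 2 + k + 1) ≠ 0 := by
    intro h
    rw [h, mul_zero] at hmul
    exact h1 hmul
  rw [hmul]
  generalize (ascPochhammer ℝ (n - k)).eval (((d : ℝ) - 2) / 2 + k + 1) = y at h3 ⊢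
  field_simp

theorem gegenbauerCoeff_zero (d n : ℕ) : gegenbauerCoeff d n 0 = 1 := by
  simp [gegenbauerCoeff]

theorem gegenbauerCoeff_eq_zero (d : ℕ) {n k : ℕ} (h : n < k) : gegenbauerCoeff d n k = 0 := by
  simp [gegenbauerCoeff, Nat.choose_eq_zero_of_lt h]

theorem normGegenbauer_eq_sum_of_lt {d : ℕ} (hd : 2 ≤ d) {n N : ℕ} (h : n < N) (t : ℝ) :
    normGegenbauer d n t = ∑ k ∈ range N, gegenbauerCoeff d n k * ((t - 1) / 2) ^ k := by
  rw [normGegenbauer_eq_sum hd]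
  refine sum_subset (range_mono h) fun k _ hk => ?_
  rw [gegenbauerCoeff_eq_zero d (by simpa [Nat.lt_succ_iff] using hk), zero_mul]

/-- This is the three-term recurrence read off at `((t - 1) / 2) ^ (j + 1)`, with `t = 1 + 2 · (t -
1) / 2`. All four coefficients become rational multiples of `A * B / E`; the prefactors `n + d` and
`n + 1` absorb the denominators created by shifting `n`. -/
theorem gegenbauerCoeff_recurrence {d : ℕ} (hd : 2 ≤ d) (n j : ℕ) :
    ((n : ℝ) + d) * gegenbauerCoeff d (n + 2) (j + 1)
        + ((n : ℝ) + 1) * gegenbauerCoeff d n (j + 1)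
        - (2 * (n : ℝ) + d + 1) * gegenbauerCoeff d (n + 1) (j + 1)
      = 2 * (2 * (n : ℝ) + d + 1) * gegenbauerCoeff d (n + 1) j := by
  have hd' : (2 : ℝ) ≤ d := by exact_mod_cast hd
  have hr : ∀ x : ℝ, (ascPochhammer ℝ (j + 1)).eval x
      = (ascPochhammer ℝ j).eval x * (x + j) := fun x => ascPochhammer_succ_eval j x
  have hl : ∀ x : ℝ, (ascPochhammer ℝ (j + 1)).eval x
      = x * (ascPochhammer ℝ j).eval (x + 1) := fun x => by
    rw [ascPochhammer_succ_left]
    simp [Polynomial.eval_comp]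
  set A := (ascPochhammer ℝ j).eval ((n : ℝ) + d) with hA
  set B := (((n + 1).choose j : ℕ) : ℝ) with hB
  set E := (ascPochhammer ℝ j).eval ((d : ℝ) / 2) with hE
  have hEpos : 0 < E := ascPochhammer_pos j _ (by linarith)
  have hA0 : (ascPochhammer ℝ (j + 1)).eval ((n : ℝ) + d - 1) = ((n : ℝ) + d - 1) * A := by
    rw [hl, hA]; congr 2; ring
  have hA1 : (ascPochhammer ℝ (j + 1)).eval ((n : ℝ) + d) = A * ((n : ℝ) + d + j) := hr _
  have hA2 : ((n : ℝ) + d) * (ascPochhammer ℝ (j + 1)).eval ((n : ℝ) + d + 1)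
      = A * ((n : ℝ) + d + j) * ((n : ℝ) + d + 1 + j) := by
    rw [hr ((n : ℝ) + d + 1), ← hA1, hl]; ring
  have hj : ((j : ℝ) + 1) ≠ 0 := by positivity
  have hB1 : ((n + 1).choose (j + 1) : ℝ) * (j + 1) = B * ((n : ℝ) + 1 - j) := by
    rcases le_or_gt j (n + 1) with h | h
    · have h' := Nat.choose_succ_right_eq (n + 1) j
      have h'' : (((n + 1).choose (j + 1) * (j + 1) : ℕ) : ℝ)
        = ((n + 1).choose j * (n + 1 - j) : ℕ) := by rw [h']
      rw [Nat.cast_mul, Nat.cast_mul, Nat.cast_sub h] at h''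
      push_cast at h''
      exact h''
    · simp [hB, Nat.choose_eq_zero_of_lt h, Nat.choose_eq_zero_of_lt (Nat.lt_succ_of_lt h)]
  have hB2 : ((n + 2).choose (j + 1) : ℝ) * (j + 1) = B * ((n : ℝ) + 2) := by
    have h' : (((n + 1 + 1) * (n + 1).choose j : ℕ) : ℝ)
      = ((n + 2).choose (j + 1) * (j + 1) : ℕ) := by rw [Nat.add_one_mul_choose_eq]
    push_cast at h'
    rw [hB]
    linarith
  have hB0 : ((n : ℝ) + 1) * (n.choose (j + 1) : ℝ)
      = ((n + 1).choose (j + 1) : ℝ) * ((n : ℝ) - j) := by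
    rcases le_or_gt j n with h | h
    · have h' := Nat.add_one_mul_choose_eq n (j + 1)
      have h2 := Nat.choose_succ_right_eq (n + 1) (j + 1)
      have h3 : (((n + 1) * n.choose (j + 1) : ℕ) : ℝ)
        = ((n + 1).choose (j + 1) * (n + 1 - (j + 1)) : ℕ) := by rw [h', h2]
      rw [Nat.cast_mul, Nat.cast_mul, Nat.cast_sub (by omega)] at h3
      push_cast at h3
      rw [h3]; ring
    · simp [Nat.choose_eq_zero_of_lt (Nat.lt_succ_of_lt h),
        Nat.choose_eq_zero_of_lt (Nat.succ_lt_succ h)]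
  have hC1 : ((n + 1).choose (j + 1) : ℝ) = B * ((n : ℝ) + 1 - j) / (j + 1) := by
    rw [eq_div_iff hj, hB1]
  have hC2 : ((n + 2).choose (j + 1) : ℝ) = B * ((n : ℝ) + 2) / (j + 1) := by
    rw [eq_div_iff hj, hB2]
  have hEj : (d : ℝ) / 2 + j ≠ 0 := by positivity
  have e1 : ((n + 1 : ℕ) : ℝ) + d - 1 = n + d := by push_cast; ring
  have e2 : ((n + 2 : ℕ) : ℝ) + d - 1 = n + d + 1 := by push_cast; ring
  have t2 : ((n : ℝ) + d) * gegenbauerCoeff d (n + 2) (j + 1)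
      = B * ((n : ℝ) + 2) / (j + 1) * (A * ((n : ℝ) + d + j) * ((n : ℝ) + d + 1 + j))
        / (E * ((d : ℝ) / 2 + j)) := by
    rw [gegenbauerCoeff, e2, hC2, hr ((d : ℝ) / 2), ← hA2]; ring
  have t0 : ((n : ℝ) + 1) * gegenbauerCoeff d n (j + 1)
      = B * ((n : ℝ) + 1 - j) / (j + 1) * ((n : ℝ) - j) * (((n : ℝ) + d - 1) * A)
        / (E * ((d : ℝ) / 2 + j)) := by
    rw [gegenbauerCoeff, hA0, hr ((d : ℝ) / 2), ← hC1, ← hB0]; ring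
  have t1 : gegenbauerCoeff d (n + 1) (j + 1)
      = B * ((n : ℝ) + 1 - j) / (j + 1) * (A * ((n : ℝ) + d + j))
        / (E * ((d : ℝ) / 2 + j)) := by
    rw [gegenbauerCoeff, e1, hA1, hr ((d : ℝ) / 2), ← hC1]
  have tj : gegenbauerCoeff d (n + 1) j = B * A / E := by
    rw [gegenbauerCoeff, e1]
  have hE0 := hEpos.ne'
  rw [t2, t0, t1, tj]
  field_simp
  ring

theorem normGegenbauer_recurrence {d : ℕ} (hd : 2 ≤ d) (n : ℕ) (t : ℝ) :
    ((n : ℝ) + d) * normGegenbauer d (n + 2) t + ((n : ℝ) + 1) * normGegenbauer d n t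
      = (2 * (n : ℝ) + d + 1) * t * normGegenbauer d (n + 1) t := by
  have h : ((n : ℝ) + d) * normGegenbauer d (n + 2) t + ((n : ℝ) + 1) * normGegenbauer d n t
      - (2 * (n : ℝ) + d + 1) * normGegenbauer d (n + 1) t
      = 2 * (2 * (n : ℝ) + d + 1) * normGegenbauer d (n + 1) t * ((t - 1) / 2) := by
    rw [normGegenbauer_eq_sum_of_lt hd (show n + 2 < n + 3 by omega),
      normGegenbauer_eq_sum_of_lt hd (show n < n + 3 by omega),
      normGegenbauer_eq_sum_of_lt hd (show n + 1 < n + 3 by omega), mul_sum, mul_sum, mul_sum,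
      ← sum_add_distrib, ← sum_sub_distrib, sum_range_succ',
      ← normGegenbauer_eq_sum_of_lt hd (show n + 1 < n + 3 by omega),
      normGegenbauer_eq_sum_of_lt hd (show n + 1 < n + 2 by omega), mul_sum, sum_mul]
    simp only [gegenbauerCoeff_zero]
    have h0 : ((n : ℝ) + d) * (1 * ((t - 1) / 2) ^ 0) + ((n : ℝ) + 1) * (1 * ((t - 1) / 2) ^ 0)
        - (2 * (n : ℝ) + d + 1) * (1 * ((t - 1) / 2) ^ 0) = 0 := by ring
    rw [h0, add_zero]
    refine sum_congr rfl fun j _ => ?_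
    linear_combination ((t - 1) / 2) ^ (j + 1) * gegenbauerCoeff_recurrence hd n j
  linear_combination h

theorem normGegenbauer_zero {d : ℕ} (hd : 2 ≤ d) (t : ℝ) : normGegenbauer d 0 t = 1 := by
  simp [normGegenbauer_eq_sum hd, gegenbauerCoeff]

theorem normGegenbauer_one {d : ℕ} (hd : 2 ≤ d) (t : ℝ) : normGegenbauer d 1 t = t := by
  have hd' : (d : ℝ) ≠ 0 := by positivity
  simp [normGegenbauer_eq_sum hd, gegenbauerCoeff, sum_range_succ]
  field_simp
  ring

/-! ### Pointwise bounds from a decreasing energy -/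

/-- The left side is `q² - 2tqr + r²` with `q = P_{n+1}`, `r = P_n`, which is symmetric in `q` and
`r`. The recurrence gives `P_{n+2} - tq = c (tq - r)` with `c = (n + 1)/(n + d) ≤ 1`, so the form
does not increase with `n`; at `n = 0` it equals `1 - t²`. -/
theorem gegenbauer_energy_le {d : ℕ} (hd : 2 ≤ d) (n : ℕ) (t : ℝ) :
    (normGegenbauer d (n + 1) t - t * normGegenbauer d n t) ^ 2
      + (1 - t ^ 2) * normGegenbauer d n t ^ 2 ≤ 1 - t ^ 2 := by
  induction n with
  | zero => simp [normGegenbauer_zero hd, normGegenbauer_one hd]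
  | succ n ih =>
    have hd' : (2 : ℝ) ≤ d := by exact_mod_cast hd
    have hrec := normGegenbauer_recurrence hd n t
    have hpos : 0 < (n : ℝ) + d := by positivity
    set q := normGegenbauer d (n + 1) t
    set r := normGegenbauer d n t
    have hstep : normGegenbauer d (n + 1 + 1) t - t * q
        = ((n : ℝ) + 1) / (n + d) * (t * q - r) := by
      field_simp
      linear_combination hrec
    have hc : (((n : ℝ) + 1) / (n + d)) ^ 2 ≤ 1 :=
      pow_le_one₀ (by positivity) ((div_le_one hpos).2 (by linarith))
    rw [hstep, mul_pow]
    nlinarith [mul_le_mul_of_nonneg_right hc (sq_nonneg (t * q - r))]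

theorem abs_normGegenbauer_sub_le {d : ℕ} (hd : 2 ≤ d) (n : ℕ) {θ : ℝ}
    (hθ : θ ∈ Set.Icc 0 Real.pi) :
    |normGegenbauer d (n + 1) (Real.cos θ) - Real.cos θ * normGegenbauer d n (Real.cos θ)|
      ≤ θ := by
  have h := gegenbauer_energy_le hd n (Real.cos θ)
  have hs : 1 - Real.cos θ ^ 2 = Real.sin θ ^ 2 := by
    linarith [Real.sin_sq_add_cos_sq θ]
  have h2 : (0 : ℝ) ≤ Real.sin θ := Real.sin_nonneg_of_mem_Icc hθ
  refine (abs_le_of_sq_le_sq ?_ h2).trans (Real.sin_le hθ.1)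
  rw [hs] at h
  nlinarith [mul_nonneg (sq_nonneg (Real.sin θ))
    (sq_nonneg (normGegenbauer d n (Real.cos θ)))]

/-- For `t² < 1`, divide the energy bound by `1 - t²`. At the endpoints the energy bound degenerates
and forces `P_{n+1} = t P_n`. -/
theorem abs_normGegenbauer_le_one {d : ℕ} (hd : 2 ≤ d) (n : ℕ) {t : ℝ}
    (ht : t ∈ Set.Icc (-1 : ℝ) 1) : |normGegenbauer d n t| ≤ 1 := by
  rcases eq_or_lt_of_le (show t ^ 2 ≤ 1 by nlinarith [ht.1, ht.2]) with h1 | h1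
  · induction n with
    | zero => simp [normGegenbauer_zero hd]
    | succ n ih =>
      have h := gegenbauer_energy_le hd n t
      rw [h1, sub_self, zero_mul, add_zero] at h
      have h0 : normGegenbauer d (n + 1) t = t * normGegenbauer d n t := by
        have := pow_eq_zero_iff (two_ne_zero) |>.1 (le_antisymm h (sq_nonneg _))
        linarith
      rw [h0, abs_mul]
      exact mul_le_one₀ (abs_le.2 ht) (abs_nonneg _) ih
  · have h := gegenbauer_energy_le hd n t
    rw [← sq_le_one_iff_abs_le_one]
    by_contra! hc
    nlinarith [sq_nonneg (normGegenbauer d (n + 1) t - t * normGegenbauer d n t)]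

theorem abs_normGegenbauer_sub_succ_le {d : ℕ} (hd : 2 ≤ d) (n : ℕ) {θ : ℝ}
    (hθ : θ ∈ Set.Icc 0 Real.pi) :
    |normGegenbauer d n (Real.cos θ) - normGegenbauer d (n + 1) (Real.cos θ)| ≤ 3 * θ := by
  have h1 := abs_normGegenbauer_sub_le hd n hθ
  have h2 := abs_normGegenbauer_le_one hd n (Real.cos_mem_Icc θ)
  -- Used through `P_n - P_{n+1} = (1 - t) P_n - (P_{n+1} - t P_n)`: the two terms contribute `2θ`
  -- and `θ`.
  have h3 : 1 - Real.cos θ ≤ 2 * θ := by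
    rcases le_total θ 1 with h | h
    · nlinarith [Real.one_sub_sq_div_two_le_cos (x := θ), hθ.1]
    · linarith [Real.neg_one_le_cos θ]
  have h4 : 0 ≤ 1 - Real.cos θ := by linarith [Real.cos_le_one θ]
  rw [abs_le] at h1 h2 ⊢
  constructor <;> nlinarith

end SphericalFilter

/-! ### Dimensions and Christoffel-Darboux weights -/

namespace SphericalFilter

open Finset

/-- The weight `(n + d - 1) Γ(n + d - 1) / (Γ(d) Γ(n + 1))` of the Christoffel-Darboux formula
for the normalised Gegenbauer polynomials. -/
noncomputable def darbouxWeight (d n : ℕ) : ℝ :=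
  ((n : ℝ) + d - 1) * Real.Gamma ((n : ℝ) + d - 1)
    / (Real.Gamma (d : ℝ) * Real.Gamma ((n : ℝ) + 1))

theorem harmonicDim_mul (d n : ℕ) :
    harmonicDim d n * ((n : ℝ) + d - 1) = darbouxWeight d n * (2 * (n : ℝ) + d - 1) := by
  rw [harmonicDim, darbouxWeight]; ring

/-- Together with `harmonicDim_mul`, this symmetrises the recurrence: multiplied by `Z_n`, its two
outer coefficients become `w_n` and `w_{n-1}`, and `Z_n = w_n + w_{n-1}`. -/
theorem darbouxWeight_succ_mul {d : ℕ} (hd : 2 ≤ d) (n : ℕ) :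
    darbouxWeight d n * (2 * (n : ℝ) + d + 1) = harmonicDim d (n + 1) * ((n : ℝ) + 1) := by
  have hd' : (2 : ℝ) ≤ d := by exact_mod_cast hd
  have h1 : Real.Gamma (((n + 1 : ℕ) : ℝ) + d - 1)
      = ((n : ℝ) + d - 1) * Real.Gamma ((n : ℝ) + d - 1) := by
    rw [← Real.Gamma_add_one (by have : (0 : ℝ) ≤ n := n.cast_nonneg; linarith)]
    congr 1; push_cast; ring
  have h2 : Real.Gamma (((n + 1 : ℕ) : ℝ) + 1)
      = ((n : ℝ) + 1) * Real.Gamma ((n : ℝ) + 1) := by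
    rw [← Real.Gamma_add_one (by positivity)]
    push_cast; rfl
  have h3 : (0 : ℝ) < Real.Gamma d := Real.Gamma_pos_of_pos (by linarith)
  have h4 : (0 : ℝ) < Real.Gamma ((n : ℝ) + 1) := Real.Gamma_pos_of_pos (by positivity)
  rw [harmonicDim, darbouxWeight, h1, h2]
  push_cast
  field_simp
  ring

theorem harmonicDim_zero (d : ℕ) : harmonicDim d 0 = darbouxWeight d 0 := by
  rw [harmonicDim, darbouxWeight]; simp

theorem darbouxWeight_eq {d : ℕ} (hd : 2 ≤ d) (n : ℕ) :
    darbouxWeight d n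
      = ((n : ℝ) + d - 1) * ((n + 1).ascFactorial (d - 2) : ℝ) / ((d - 1).factorial : ℝ) := by
  obtain ⟨e, rfl⟩ := Nat.exists_eq_add_of_le' hd
  have h1 : Real.Gamma ((n : ℝ) + ((e + 2 : ℕ) : ℝ) - 1) = ((n + e).factorial : ℝ) := by
    rw [← Real.Gamma_nat_eq_factorial]; congr 1; push_cast; ring
  have h2 : Real.Gamma ((e + 2 : ℕ) : ℝ) = ((e + 1).factorial : ℝ) := by
    rw [← Real.Gamma_nat_eq_factorial]; congr 1; push_cast; ring
  have h3 : ((n.factorial : ℝ)) * ((n + 1).ascFactorial e : ℝ) = ((n + e).factorial : ℝ) := by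
    exact_mod_cast Nat.factorial_mul_ascFactorial n e
  have h4 : (n.factorial : ℝ) ≠ 0 := by exact_mod_cast n.factorial_ne_zero
  rw [darbouxWeight, h1, h2, Real.Gamma_nat_eq_factorial, ← h3]
  simp only [Nat.add_sub_cancel, show e + 2 - 1 = e + 1 by omega]
  field_simp

theorem darbouxWeight_nonneg {d : ℕ} (hd : 2 ≤ d) (n : ℕ) : 0 ≤ darbouxWeight d n := by
  have hd' : (2 : ℝ) ≤ d := by exact_mod_cast hd
  have : (0 : ℝ) ≤ n := n.cast_nonneg
  rw [darbouxWeight_eq hd]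
  have : 0 ≤ (n : ℝ) + d - 1 := by linarith
  positivity

theorem darbouxWeight_le {d : ℕ} (hd : 2 ≤ d) (n : ℕ) :
    darbouxWeight d n ≤ ((n : ℝ) + d) ^ (d - 1) := by
  rw [darbouxWeight_eq hd]
  obtain ⟨e, rfl⟩ := Nat.exists_eq_add_of_le' hd
  have h1 : (((n + 1).ascFactorial e : ℕ) : ℝ) ≤ ((n : ℝ) + (e + 2 : ℕ)) ^ e := by
    have := Nat.ascFactorial_le_pow_add n e
    have h2 : (((n + 1).ascFactorial e : ℕ) : ℝ) ≤ ((n : ℝ) + e) ^ e := by exact_mod_cast this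
    refine h2.trans (pow_le_pow_left₀ (by positivity) ?_ _)
    push_cast; linarith
  have h3 : (1 : ℝ) ≤ ((e + 2 - 1).factorial : ℝ) := by
    exact_mod_cast Nat.succ_le_of_lt (Nat.factorial_pos _)
  have h0 : (0 : ℝ) ≤ (n : ℝ) + (e + 2 : ℕ) - 1 := by
    push_cast
    linarith [n.cast_nonneg (α := ℝ), e.cast_nonneg (α := ℝ)]
  simp only [Nat.add_sub_cancel]
  refine (div_le_self (by positivity) h3).trans ?_
  rw [show e + 2 - 1 = e + 1 by omega, pow_succ']
  exact mul_le_mul (by linarith) h1 (by positivity) (by positivity)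

theorem harmonicDim_nonneg {d : ℕ} (hd : 2 ≤ d) (n : ℕ) : 0 ≤ harmonicDim d n := by
  have hd' : (2 : ℝ) ≤ d := by exact_mod_cast hd
  have h0 : (0 : ℝ) ≤ n := n.cast_nonneg
  have h1 : 0 < (n : ℝ) + d - 1 := by linarith
  refine nonneg_of_mul_nonneg_left ?_ h1
  rw [harmonicDim_mul d]
  exact mul_nonneg (darbouxWeight_nonneg hd n) (by linarith)

theorem harmonicDim_le {d : ℕ} (hd : 2 ≤ d) (n : ℕ) :
    harmonicDim d n ≤ 2 * ((n : ℝ) + d) ^ (d - 1) := by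
  have hd' : (2 : ℝ) ≤ d := by exact_mod_cast hd
  have h0 : (0 : ℝ) ≤ n := n.cast_nonneg
  have h1 : 0 < (n : ℝ) + d - 1 := by linarith
  have h2 := harmonicDim_mul d n
  have h3 : harmonicDim d n ≤ 2 * darbouxWeight d n := by
    refine le_of_mul_le_mul_right ?_ h1
    rw [h2]
    nlinarith [darbouxWeight_nonneg hd n]
  linarith [darbouxWeight_le hd n]

/-! ### Summation by parts -/

/-- The second order difference operator on sequences which corresponds to multiplication of
`∑ h n * harmonicDim d n * normGegenbauer d n t` by `1 - t`. -/
noncomputable def diffOp (d : ℕ) (h : ℕ → ℝ) (n : ℕ) : ℝ :=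
  (((n : ℝ) + d - 1) * (h n - h (n + 1)) + n * (h n - h (n - 1))) / (2 * (n : ℝ) + d - 1)

/-- Discrete Green identity for the symmetrised recurrence: what remains is a Casoratian boundary
term, which vanishes once `h` is zero at `N` and `N + 1`. -/
theorem sum_diffOp {d : ℕ} (hd : 2 ≤ d) (h : ℕ → ℝ) (t : ℝ) (N : ℕ) :
    ∑ n ∈ range (N + 1),
        ((1 - t) * h n - diffOp d h n) * harmonicDim d n * normGegenbauer d n t
      = darbouxWeight d N * (normGegenbauer d N t * h (N + 1)
          - h N * normGegenbauer d (N + 1) t) := by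
  have hd' : (2 : ℝ) ≤ d := by exact_mod_cast hd
  induction N with
  | zero =>
    have h1 : (d : ℝ) - 1 ≠ 0 := by linarith
    -- The truncated index `n - 1` at `n = 0` is harmless, since its difference carries the factor
    -- `n`.
    simp [diffOp, normGegenbauer_zero hd, normGegenbauer_one hd, harmonicDim_zero d]
    field_simp
    ring
  | succ N ih =>
    have h0 : (0 : ℝ) ≤ N := N.cast_nonneg
    rw [sum_range_succ, ih]
    have hrec := normGegenbauer_recurrence hd N t
    have hw1 := harmonicDim_mul d (N + 1)
    have hw2 := darbouxWeight_succ_mul hd N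
    have hden : 2 * (N : ℝ) + d + 1 ≠ 0 := by linarith
    have hL : diffOp d h (N + 1) * (2 * (N : ℝ) + d + 1)
        = ((N : ℝ) + d) * (h (N + 1) - h (N + 1 + 1)) + ((N : ℝ) + 1) * (h (N + 1) - h N) := by
      rw [diffOp, show (2 * ((N + 1 : ℕ) : ℝ) + d - 1) = 2 * (N : ℝ) + d + 1 by push_cast; ring,
        div_mul_cancel₀ _ hden]
      push_cast
      ring_nf
    push_cast at hw1
    refine mul_right_cancel₀ hden ?_
    set q := normGegenbauer d (N + 1) t
    set r := normGegenbauer d N t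
    set s := normGegenbauer d (N + 1 + 1) t
    set Z := harmonicDim d (N + 1)
    linear_combination (-Z * q) * hL + (Z * h (N + 1)) * hrec
      + (r * h (N + 1) - h N * q) * hw2
      + (q * h (N + 1 + 1) - h (N + 1) * s) * hw1

/-- Abel summation applied to `(1 - t) Z_n P_n = w_n (P_n - P_{n+1}) - w_{n-1} (P_{n-1} - P_n)`. It
costs only one difference of `h`, which is what odd `κ` affords. -/
theorem sum_one_sub_mul {d : ℕ} (hd : 2 ≤ d) (h : ℕ → ℝ) (t : ℝ) (N : ℕ) :
    ∑ n ∈ range (N + 1), (1 - t) * h n * harmonicDim d n * normGegenbauer d n t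
      = ∑ n ∈ range N, (h n - h (n + 1)) * darbouxWeight d n
          * (normGegenbauer d n t - normGegenbauer d (n + 1) t)
        + h N * darbouxWeight d N * (normGegenbauer d N t - normGegenbauer d (N + 1) t) := by
  have hd' : (2 : ℝ) ≤ d := by exact_mod_cast hd
  induction N with
  | zero =>
    simp [normGegenbauer_zero hd, normGegenbauer_one hd, harmonicDim_zero d]
    ring
  | succ N ih =>
    have h0 : (0 : ℝ) ≤ N := N.cast_nonneg
    rw [sum_range_succ, ih, sum_range_succ]
    have hrec := normGegenbauer_recurrence hd N t
    have hw1 := harmonicDim_mul d (N + 1)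
    have hw2 := darbouxWeight_succ_mul hd N
    have hden : 2 * (N : ℝ) + d + 1 ≠ 0 := by linarith
    push_cast at hw1
    refine mul_right_cancel₀ hden ?_
    set q := normGegenbauer d (N + 1) t
    set r := normGegenbauer d N t
    set s := normGegenbauer d (N + 1 + 1) t
    set Z := harmonicDim d (N + 1)
    linear_combination (Z * h (N + 1)) * hrec + h (N + 1) * (r - q) * hw2
      + h (N + 1) * (q - s) * hw1

/-- The series `∑ h n * harmonicDim d n * normGegenbauer d n t`. -/
noncomputable def gegenbauerSeries (d : ℕ) (h : ℕ → ℝ) (t : ℝ) : ℝ :=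
  ∑' n : ℕ, h n * harmonicDim d n * normGegenbauer d n t

theorem gegenbauerSeries_eq_sum {d : ℕ} {h : ℕ → ℝ} {N : ℕ} (hN : ∀ n, N ≤ n → h n = 0)
    (t : ℝ) :
    gegenbauerSeries d h t = ∑ n ∈ range N, h n * harmonicDim d n * normGegenbauer d n t := by
  refine tsum_eq_sum fun n hn => ?_
  rw [hN n (by simpa using hn), zero_mul, zero_mul]

theorem diffOp_eq_zero {d : ℕ} {h : ℕ → ℝ} {N : ℕ} (hN : ∀ n, N ≤ n → h n = 0) (n : ℕ)
    (hn : N + 1 ≤ n) : diffOp d h n = 0 := by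
  rw [diffOp, hN n (by omega), hN (n + 1) (by omega), hN (n - 1) (by omega)]
  simp

theorem gegenbauerSeries_diffOp {d : ℕ} (hd : 2 ≤ d) {h : ℕ → ℝ} {N : ℕ}
    (hN : ∀ n, N ≤ n → h n = 0) (t : ℝ) :
    gegenbauerSeries d (diffOp d h) t = (1 - t) * gegenbauerSeries d h t := by
  have h1 := sum_diffOp hd h t N
  rw [hN N le_rfl, hN (N + 1) (by omega)] at h1
  rw [gegenbauerSeries_eq_sum (N := N + 1) (diffOp_eq_zero hN),
    gegenbauerSeries_eq_sum (N := N + 1) fun n hn => hN n (by omega), mul_sum, eq_comm,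
    ← sub_eq_zero, ← sum_sub_distrib]
  simp only [mul_zero, zero_mul, sub_zero] at h1
  rw [← h1]
  refine sum_congr rfl fun n _ => ?_
  ring

theorem gegenbauerSeries_iterate_diffOp {d : ℕ} (hd : 2 ≤ d) (m : ℕ) {h : ℕ → ℝ} {N : ℕ}
    (hN : ∀ n, N ≤ n → h n = 0) (t : ℝ) :
    gegenbauerSeries d ((diffOp d)^[m] h) t = (1 - t) ^ m * gegenbauerSeries d h t
      ∧ ∀ n, N + m ≤ n → (diffOp d)^[m] h n = 0 := by
  induction m with
  | zero => simpa using hN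
  | succ m ih =>
    rw [Function.iterate_succ_apply']
    refine ⟨?_, diffOp_eq_zero ih.2⟩
    rw [gegenbauerSeries_diffOp hd ih.2, ih.1, pow_succ']
    ring

theorem abs_gegenbauerSeries_le {d : ℕ} (hd : 2 ≤ d) {h : ℕ → ℝ} {N : ℕ}
    (hN : ∀ n, N ≤ n → h n = 0) {B : ℝ} (hB : ∀ n, |h n| ≤ B) {t : ℝ}
    (ht : t ∈ Set.Icc (-1 : ℝ) 1) :
    |gegenbauerSeries d h t| ≤ 2 * B * ((N : ℝ) + d) ^ d := by
  have hB0 : 0 ≤ B := (abs_nonneg _).trans (hB 0)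
  rw [gegenbauerSeries_eq_sum hN]
  have hterm : ∀ n ∈ range N, |h n * harmonicDim d n * normGegenbauer d n t|
      ≤ 2 * B * ((N : ℝ) + d) ^ (d - 1) := by
    intro n hn
    have hnN : (n : ℝ) ≤ N := by exact_mod_cast (mem_range.1 hn).le
    have h1 : harmonicDim d n ≤ 2 * ((N : ℝ) + d) ^ (d - 1) :=
      (harmonicDim_le hd n).trans (by gcongr)
    rw [abs_mul, abs_mul, abs_of_nonneg (harmonicDim_nonneg hd n)]
    calc |h n| * harmonicDim d n * |normGegenbauer d n t|
        ≤ B * (2 * ((N : ℝ) + d) ^ (d - 1)) * 1 :=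
          mul_le_mul (mul_le_mul (hB n) h1 (harmonicDim_nonneg hd n) hB0)
            (abs_normGegenbauer_le_one hd n ht) (abs_nonneg _) (by positivity)
      _ = _ := by ring
  refine (abs_sum_le_sum_abs _ _).trans ((sum_le_card_nsmul _ _ _ hterm).trans ?_)
  rw [card_range, nsmul_eq_mul]
  obtain ⟨e, rfl⟩ := Nat.exists_eq_add_of_le' hd
  rw [show e + 2 - 1 = e + 1 by omega, pow_succ _ (e + 1)]
  have : (N : ℝ) ≤ (N : ℝ) + ((e + 2 : ℕ) : ℝ) :=
    le_add_of_nonneg_right (Nat.cast_nonneg _)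
  calc (N : ℝ) * (2 * B * ((N : ℝ) + ((e + 2 : ℕ) : ℝ)) ^ (e + 1))
      ≤ ((N : ℝ) + ((e + 2 : ℕ) : ℝ)) * (2 * B * ((N : ℝ) + ((e + 2 : ℕ) : ℝ)) ^ (e + 1)) := by
        gcongr
    _ = _ := by ring

theorem abs_one_sub_mul_gegenbauerSeries_le {d : ℕ} (hd : 2 ≤ d) {h : ℕ → ℝ} {N : ℕ}
    (hN : ∀ n, N ≤ n → h n = 0) {B : ℝ} (hB : ∀ n, |h (n + 1) - h n| ≤ B) {θ : ℝ}
    (hθ : θ ∈ Set.Icc 0 Real.pi) :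
    |(1 - Real.cos θ) * gegenbauerSeries d h (Real.cos θ)|
      ≤ 3 * θ * B * ((N : ℝ) + d) ^ d := by
  have hB0 : 0 ≤ B := (abs_nonneg _).trans (hB 0)
  have hθ0 := hθ.1
  have h1 := sum_one_sub_mul hd h (Real.cos θ) N
  rw [hN N le_rfl, zero_mul, zero_mul, add_zero] at h1
  rw [gegenbauerSeries_eq_sum (N := N + 1) fun n hn => hN n (by omega), mul_sum]
  simp only [← mul_assoc]
  rw [h1]
  have hterm : ∀ n ∈ range N, |(h n - h (n + 1)) * darbouxWeight d n
      * (normGegenbauer d n (Real.cos θ) - normGegenbauer d (n + 1) (Real.cos θ))|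
      ≤ 3 * θ * B * ((N : ℝ) + d) ^ (d - 1) := by
    intro n hn
    have hnN : (n : ℝ) ≤ N := by exact_mod_cast (mem_range.1 hn).le
    have h1 : darbouxWeight d n ≤ ((N : ℝ) + d) ^ (d - 1) :=
      (darbouxWeight_le hd n).trans (by gcongr)
    rw [abs_mul, abs_mul, abs_of_nonneg (darbouxWeight_nonneg hd n), abs_sub_comm (h n)]
    calc _ ≤ B * ((N : ℝ) + d) ^ (d - 1) * (3 * θ) :=
          mul_le_mul (mul_le_mul (hB n) h1 (darbouxWeight_nonneg hd n) hB0)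
            (abs_normGegenbauer_sub_succ_le hd n hθ) (abs_nonneg _) (by positivity)
      _ = _ := by ring
  refine (abs_sum_le_sum_abs _ _).trans ((sum_le_card_nsmul _ _ _ hterm).trans ?_)
  rw [card_range, nsmul_eq_mul]
  obtain ⟨e, rfl⟩ := Nat.exists_eq_add_of_le' hd
  rw [show e + 2 - 1 = e + 1 by omega, pow_succ _ (e + 1)]
  have : (N : ℝ) ≤ (N : ℝ) + ((e + 2 : ℕ) : ℝ) :=
    le_add_of_nonneg_right (Nat.cast_nonneg _)
  calc (N : ℝ) * (3 * θ * B * ((N : ℝ) + ((e + 2 : ℕ) : ℝ)) ^ (e + 1))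
      ≤ ((N : ℝ) + ((e + 2 : ℕ) : ℝ)) * (3 * θ * B * ((N : ℝ) + ((e + 2 : ℕ) : ℝ)) ^ (e + 1)) := by
        gcongr
    _ = _ := by ring

end SphericalFilter

/-! ### Discrete symbol calculus -/

namespace SphericalFilter

/-- A family of sequences, indexed by `T ≥ 1`, is symbol bounded to order `j` with decay `s` if
its forward differences of order `i ≤ j` are `O(T ^ (-(s + i)))` on the indices
`n ≥ ε T + r`. -/
def SymbolBounded (ε : ℝ) : ℕ → ℕ → ℕ → (ℝ → ℕ → ℝ) → Prop
  | 0, s, r, f => ∃ C : ℝ, ∀ T : ℝ, 1 ≤ T → ∀ n : ℕ, ε * T + r ≤ n → |f T n| ≤ C / T ^ s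
  | j + 1, s, r, f =>
    (∃ C : ℝ, ∀ T : ℝ, 1 ≤ T → ∀ n : ℕ, ε * T + r ≤ n → |f T n| ≤ C / T ^ s)
      ∧ SymbolBounded ε j (s + 1) r (fun T n => f T (n + 1) - f T n)

namespace SymbolBounded

variable {ε : ℝ} {j s s' r : ℕ} {f g : ℝ → ℕ → ℝ}

theorem bound (h : SymbolBounded ε j s r f) :
    ∃ C : ℝ, ∀ T : ℝ, 1 ≤ T → ∀ n : ℕ, ε * T + r ≤ n → |f T n| ≤ C / T ^ s := by
  cases j with
  | zero => exact h
  | succ j => exact h.1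

theorem of_succ (h : SymbolBounded ε (j + 1) s r f) : SymbolBounded ε j s r f := by
  induction j generalizing s f with
  | zero => exact h.1
  | succ j ih => exact ⟨h.1, ih h.2⟩

theorem of_le {j' : ℕ} (hj : j ≤ j') (h : SymbolBounded ε j' s r f) :
    SymbolBounded ε j s r f := by
  induction hj with
  | refl => exact h
  | step _ ih => exact ih h.of_succ

theorem congr (hfg : ∀ T : ℝ, 1 ≤ T → ∀ n : ℕ, ε * T + r ≤ n → f T n = g T n)
    (h : SymbolBounded ε j s r f) : SymbolBounded ε j s r g := by
  induction j generalizing s f g with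
  | zero =>
    obtain ⟨C, hC⟩ := h
    exact ⟨C, fun T hT n hn => hfg T hT n hn ▸ hC T hT n hn⟩
  | succ j ih =>
    obtain ⟨⟨C, hC⟩, h⟩ := h
    refine ⟨⟨C, fun T hT n hn => hfg T hT n hn ▸ hC T hT n hn⟩, ih (fun T hT n hn => ?_) h⟩
    rw [hfg T hT n hn, hfg T hT (n + 1) (by push_cast; linarith)]

theorem add (hf : SymbolBounded ε j s r f) (hg : SymbolBounded ε j s r g) :
    SymbolBounded ε j s r (fun T n => f T n + g T n) := by
  have key : ∀ {s : ℕ} {f g : ℝ → ℕ → ℝ},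
      (∃ C : ℝ, ∀ T : ℝ, 1 ≤ T → ∀ n : ℕ, ε * T + r ≤ n → |f T n| ≤ C / T ^ s) →
      (∃ C : ℝ, ∀ T : ℝ, 1 ≤ T → ∀ n : ℕ, ε * T + r ≤ n → |g T n| ≤ C / T ^ s) →
      ∃ C : ℝ, ∀ T : ℝ, 1 ≤ T → ∀ n : ℕ, ε * T + r ≤ n → |f T n + g T n| ≤ C / T ^ s := by
    rintro s f g ⟨C, hC⟩ ⟨D, hD⟩
    refine ⟨C + D, fun T hT n hn => (abs_add_le _ _).trans ?_⟩
    rw [add_div]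
    exact add_le_add (hC T hT n hn) (hD T hT n hn)
  induction j generalizing s f g with
  | zero => exact key hf hg
  | succ j ih =>
    refine ⟨key hf.1 hg.1, ?_⟩
    convert ih hf.2 hg.2 using 3
    ring

theorem shift (hf : SymbolBounded ε j s r f) :
    SymbolBounded ε j s r (fun T n => f T (n + 1)) := by
  have key : ∀ {s : ℕ} {f : ℝ → ℕ → ℝ},
      (∃ C : ℝ, ∀ T : ℝ, 1 ≤ T → ∀ n : ℕ, ε * T + r ≤ n → |f T n| ≤ C / T ^ s) →
      ∃ C : ℝ, ∀ T : ℝ, 1 ≤ T → ∀ n : ℕ, ε * T + r ≤ n → |f T (n + 1)| ≤ C / T ^ s := by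
    rintro s f ⟨C, hC⟩
    exact ⟨C, fun T hT n hn => hC T hT (n + 1) (by push_cast; linarith)⟩
  induction j generalizing s f with
  | zero => exact key hf
  | succ j ih => exact ⟨key hf.1, ih hf.2⟩

theorem weaken (hf : SymbolBounded ε j s r f) : SymbolBounded ε j s (r + 1) f := by
  have key : ∀ {s : ℕ} {f : ℝ → ℕ → ℝ},
      (∃ C : ℝ, ∀ T : ℝ, 1 ≤ T → ∀ n : ℕ, ε * T + r ≤ n → |f T n| ≤ C / T ^ s) →
      ∃ C : ℝ, ∀ T : ℝ, 1 ≤ T → ∀ n : ℕ, ε * T + (r + 1 : ℕ) ≤ n → |f T n| ≤ C / T ^ s := by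
    rintro s f ⟨C, hC⟩
    exact ⟨C, fun T hT n hn => hC T hT n (by push_cast at hn; linarith)⟩
  induction j generalizing s f with
  | zero => exact key hf
  | succ j ih => exact ⟨key hf.1, ih hf.2⟩

/-- The threshold rises by one so that `n - 1` still meets the old one; it also gives `n ≥ 1`, so
the subtraction is not truncated. -/
theorem pred (hε : 0 ≤ ε) (hf : SymbolBounded ε j s r f) :
    SymbolBounded ε j s (r + 1) (fun T n => f T (n - 1)) := by
  have hn1 : ∀ {T : ℝ} {n : ℕ}, 1 ≤ T → ε * T + (r + 1 : ℕ) ≤ n → 1 ≤ n := by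
    intro T n hT hn
    have : (0 : ℝ) ≤ ε * T := by positivity
    have h1 : (((r + 1 : ℕ)) : ℝ) ≤ n := by linarith
    have h2 : r + 1 ≤ n := by exact_mod_cast h1
    omega
  have key : ∀ {s : ℕ} {f : ℝ → ℕ → ℝ},
      (∃ C : ℝ, ∀ T : ℝ, 1 ≤ T → ∀ n : ℕ, ε * T + r ≤ n → |f T n| ≤ C / T ^ s) →
      ∃ C : ℝ, ∀ T : ℝ, 1 ≤ T → ∀ n : ℕ, ε * T + (r + 1 : ℕ) ≤ n →
        |f T (n - 1)| ≤ C / T ^ s := by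
    rintro s f ⟨C, hC⟩
    refine ⟨C, fun T hT n hn => hC T hT (n - 1) ?_⟩
    rw [Nat.cast_sub (hn1 hT hn)]
    push_cast at hn ⊢
    linarith
  induction j generalizing s f with
  | zero => exact key hf
  | succ j ih =>
    refine ⟨key hf.1, (ih hf.2).congr fun T hT n hn => ?_⟩
    have := hn1 hT hn
    simp only [Nat.add_sub_cancel, Nat.sub_add_cancel this]

/-- Discrete Leibniz rule: `Δ(fg)(n) = Δf(n) g(n) + f(n+1) Δg(n)`. -/
theorem mul (hf : SymbolBounded ε j s r f) (hg : SymbolBounded ε j s' r g) :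
    SymbolBounded ε j (s + s') r (fun T n => f T n * g T n) := by
  have key : ∀ {s s' : ℕ} {f g : ℝ → ℕ → ℝ},
      (∃ C : ℝ, ∀ T : ℝ, 1 ≤ T → ∀ n : ℕ, ε * T + r ≤ n → |f T n| ≤ C / T ^ s) →
      (∃ C : ℝ, ∀ T : ℝ, 1 ≤ T → ∀ n : ℕ, ε * T + r ≤ n → |g T n| ≤ C / T ^ s') →
      ∃ C : ℝ, ∀ T : ℝ, 1 ≤ T → ∀ n : ℕ, ε * T + r ≤ n →
        |f T n * g T n| ≤ C / T ^ (s + s') := by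
    rintro s s' f g ⟨C, hC⟩ ⟨D, hD⟩
    refine ⟨C * D, fun T hT n hn => ?_⟩
    rw [abs_mul, pow_add, mul_div_mul_comm]
    exact mul_le_mul (hC T hT n hn) (hD T hT n hn) (abs_nonneg _)
      ((abs_nonneg _).trans (hC T hT n hn))
  induction j generalizing s s' f g with
  | zero => exact key hf hg
  | succ j ih =>
    refine ⟨key hf.1 hg.1, ?_⟩
    have h1 := ih hf.2 hg.of_succ
    have h2 := ih hf.of_succ.shift hg.2
    rw [show s + 1 + s' = s + s' + 1 by ring] at h1
    rw [show s + (s' + 1) = s + s' + 1 by ring] at h2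
    convert h1.add h2 using 3
    ring

theorem const (ε : ℝ) (j r : ℕ) (c : ℝ) : SymbolBounded ε j 0 r (fun _ _ => c) := by
  have zero : ∀ (j s : ℕ), SymbolBounded ε j s r (fun _ _ => 0) := by
    intro j
    induction j with
    | zero => exact fun s => ⟨0, by simp⟩
    | succ j ih => exact fun s => ⟨⟨0, by simp⟩, by simpa using ih (s + 1)⟩
  cases j with
  | zero => exact ⟨|c|, by simp⟩
  | succ j => exact ⟨⟨|c|, by simp⟩, by simpa using zero j 1⟩

theorem const_mul (c : ℝ) (hf : SymbolBounded ε j s r f) :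
    SymbolBounded ε j s r (fun T n => c * f T n) := by
  simpa using (const ε j r c).mul hf

/-- The difference of this sequence is `-2` times its product with its own shift, so the induction
closes through `mul`. The decay comes from `n ≥ ε T`. -/
theorem inv_linear (hε : 0 < ε) {d : ℕ} (hd : 2 ≤ d) (j : ℕ) :
    SymbolBounded ε j 1 0 (fun _ n => 1 / (2 * (n : ℝ) + d - 1)) := by
  have hd' : (2 : ℝ) ≤ d := by exact_mod_cast hd
  have base : ∃ C : ℝ, ∀ T : ℝ, 1 ≤ T → ∀ n : ℕ, ε * T + (0 : ℕ) ≤ n →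
      |1 / (2 * (n : ℝ) + d - 1)| ≤ C / T ^ 1 := by
    refine ⟨1 / ε, fun T hT n hn => ?_⟩
    have hT0 : 0 < T := by linarith
    have hεT : 0 < ε * T := by positivity
    rw [Nat.cast_zero, add_zero] at hn
    rw [abs_of_nonneg (one_div_nonneg.2 (by linarith)), pow_one, div_div]
    exact one_div_le_one_div_of_le hεT (by linarith)
  induction j with
  | zero => exact base
  | succ j ih =>
    refine ⟨base, ((ih.mul ih.shift).const_mul (-2)).congr fun T _ n _ => ?_⟩
    have h0 : (0 : ℝ) ≤ n := n.cast_nonneg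
    have h1 : 2 * (n : ℝ) + d - 1 ≠ 0 := by linarith
    have h2 : 2 * ((n + 1 : ℕ) : ℝ) + d - 1 ≠ 0 := by push_cast; linarith
    field_simp
    push_cast
    ring

theorem weaken_iterate (hf : SymbolBounded ε j s 0 f) (r : ℕ) : SymbolBounded ε j s r f := by
  induction r with
  | zero => exact hf
  | succ r ih => exact ih.weaken

/-- Rests on `diffOp h n = -½ Δ²h(n-1) - ((d-1)/2) (Δh(n) + Δh(n-1)) / (2n+d-1)` for `n ≥ 1`. The
first term gains `T⁻²` by two differences, the second by one difference and the decay of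
`1/(2n+d-1)`. -/
theorem diffOp (hε : 0 < ε) {d : ℕ} (hd : 2 ≤ d) (hf : SymbolBounded ε (j + 2) s r f) :
    SymbolBounded ε j (s + 2) (r + 1) (fun T => diffOp d (f T)) := by
  have hd' : (2 : ℝ) ≤ d := by exact_mod_cast hd
  have h1 := hf.2.of_succ
  have h2 := (hf.2.2.pred hε.le).const_mul (-1 / 2)
  have h3 := (((inv_linear hε hd j).weaken_iterate (r + 1)).mul
    (h1.weaken.add (h1.pred hε.le))).const_mul (-((d : ℝ) - 1) / 2)
  rw [show 1 + (s + 1) = s + 1 + 1 by ring] at h3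
  refine (h2.add h3).congr fun T hT n hn => ?_
  have hn1 : 1 ≤ n := by
    have h4 : (0 : ℝ) ≤ ε * T := by positivity
    have h5 : (((r + 1 : ℕ)) : ℝ) ≤ n := by linarith
    have h6 : r + 1 ≤ n := by exact_mod_cast h5
    omega
  obtain ⟨k, rfl⟩ := Nat.exists_eq_add_of_le' hn1
  have h0 : (0 : ℝ) ≤ k := k.cast_nonneg
  have h7 : 2 * ((k + 1 : ℕ) : ℝ) + d - 1 ≠ 0 := by push_cast; linarith
  rw [SphericalFilter.diffOp, Nat.add_sub_cancel]
  field_simp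
  push_cast
  ring

theorem iterate_diffOp (hε : 0 < ε) {d : ℕ} (hd : 2 ≤ d) (m : ℕ)
    (hf : SymbolBounded ε (j + 2 * m) 0 0 f) :
    SymbolBounded ε j (2 * m) m (fun T => (SphericalFilter.diffOp d)^[m] (f T)) := by
  induction m generalizing j with
  | zero => exact hf
  | succ m ih =>
    simp only [Function.iterate_succ_apply']
    exact (ih (j := j + 2) (by convert hf using 1; ring)).diffOp hε hd

/-- The difference of the samples of `F T` is the sample of `F T (x + 1/T) - F T x`, so `F` must
depend on `T` for the induction. The mean value theorem trades one derivative for a factor `1/T`. -/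
theorem sample {F : ℝ → ℝ → ℝ} (ε : ℝ) (r : ℕ) (hF : ∀ T, ContDiff ℝ j (F T))
    (hb : ∀ i ≤ j, ∃ C, ∀ T : ℝ, 1 ≤ T → ∀ x, |iteratedDeriv i (F T) x| ≤ C / T ^ s) :
    SymbolBounded ε j s r (fun T n => F T (n / T)) := by
  have key : ∃ C : ℝ, ∀ T : ℝ, 1 ≤ T → ∀ n : ℕ, ε * T + r ≤ n →
      |F T (n / T)| ≤ C / T ^ s := by
    obtain ⟨C, hC⟩ := hb 0 (Nat.zero_le _)
    exact ⟨C, fun T hT n _ => by simpa using hC T hT (n / T)⟩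
  induction j generalizing s F with
  | zero => exact key
  | succ j ih =>
    have hsm : ∀ T, ContDiff ℝ (j + 1 : ℕ) (fun x => F T (x + 1 / T)) := fun T =>
      (hF T).comp (contDiff_id.add contDiff_const)
    have hlt : ((j : ℕ) : WithTop ℕ∞) ≤ ((j + 1 : ℕ) : WithTop ℕ∞) := by
      exact_mod_cast Nat.le_succ j
    have hb' : ∀ i ≤ j, ∃ C, ∀ T : ℝ, 1 ≤ T → ∀ x,
        |iteratedDeriv i (fun x => F T (x + 1 / T) - F T x) x| ≤ C / T ^ (s + 1) := by
      intro i hi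
      obtain ⟨C, hC⟩ := hb (i + 1) (by omega)
      refine ⟨C, fun T hT x => ?_⟩
      have hT0 : 0 < T := by linarith
      have hile : ((i : ℕ) : WithTop ℕ∞) ≤ ((j + 1 : ℕ) : WithTop ℕ∞) := by
        exact_mod_cast (by omega : i ≤ j + 1)
      have hilt : ((i : ℕ) : WithTop ℕ∞) < ((j + 1 : ℕ) : WithTop ℕ∞) := by
        exact_mod_cast (by omega : i < j + 1)
      have e1 : iteratedDeriv i (fun x => F T (x + 1 / T) - F T x) x
          = iteratedDeriv i (F T) (x + 1 / T) - iteratedDeriv i (F T) x := by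
        rw [iteratedDeriv_fun_sub ((hsm T).contDiffAt.of_le hile)
          ((hF T).contDiffAt.of_le hile), iteratedDeriv_comp_add_const]
      rw [e1]
      have hdiff : Differentiable ℝ (iteratedDeriv i (F T)) :=
        (hF T).differentiable_iteratedDeriv i hilt
      have hmvt := Convex.norm_image_sub_le_of_norm_deriv_le (s := Set.univ)
        (f := iteratedDeriv i (F T)) (C := C / T ^ s) (x := x) (y := x + 1 / T)
        (fun y _ => hdiff y) (fun y _ => by
          rw [← iteratedDeriv_succ]; exact hC T hT y) convex_univ trivial trivial
      rw [Real.norm_eq_abs, Real.norm_eq_abs, add_sub_cancel_left,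
        abs_of_pos (one_div_pos.2 hT0)] at hmvt
      refine hmvt.trans_eq ?_
      rw [pow_succ]
      field_simp
    refine ⟨key, (ih (F := fun T x => F T (x + 1 / T) - F T x)
      (fun T => ((hsm T).sub (hF T)).of_le hlt) hb' ?_).congr fun T hT n _ => ?_⟩
    · obtain ⟨C, hC⟩ := hb' 0 (Nat.zero_le _)
      exact ⟨C, fun T hT n _ => by simpa using hC T hT (n / T)⟩
    · push_cast
      rw [add_div]

end SymbolBounded

end SphericalFilter

/-! ### Extending the filter and locality of the difference operator -/

namespace SphericalFilter

/-- The extension of a function on `[0, ∞)` to the negative axis by its value at `0`. -/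
def constExtend (g : ℝ → ℝ) (x : ℝ) : ℝ := g (max x 0)

theorem constExtend_of_nonneg (g : ℝ → ℝ) {x : ℝ} (hx : 0 ≤ x) : constExtend g x = g x := by
  rw [constExtend, max_eq_left hx]

section Extension

variable {g : ℝ → ℝ} {a : ℝ}

theorem constExtend_eventuallyEq_const (ha : 0 < a) (hconst : ∀ t ∈ Set.Icc 0 a, g t = g 0)
    {x : ℝ} (hx : x < a) : constExtend g =ᶠ[nhds x] fun _ => g 0 := by
  filter_upwards [Iio_mem_nhds hx] with y hy
  exact hconst _ ⟨le_max_right _ _, max_le (le_of_lt hy) ha.le⟩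

theorem constExtend_eventuallyEq_zero (hg : IsFilter g) {x : ℝ} (hx : 2 < x) :
    constExtend g =ᶠ[nhds x] fun _ => 0 := by
  filter_upwards [Ioi_mem_nhds hx] with y hy
  exact hg.eq_zero _ (lt_max_of_lt_left hy)

/-- Constancy on `[0, a]` makes the extension smooth across `0`, so `SymbolBounded.sample` can work
on all of `ℝ`. -/
theorem contDiff_constExtend {κ : ℕ} (hsmooth : ContDiffOn ℝ (κ : WithTop ℕ∞) g (Set.Ici 0))
    (ha : 0 < a) (hconst : ∀ t ∈ Set.Icc 0 a, g t = g 0) :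
    ContDiff ℝ (κ : WithTop ℕ∞) (constExtend g) := by
  rw [contDiff_iff_contDiffAt]
  intro x
  rcases lt_or_ge x a with hx | hx
  · exact contDiffAt_const.congr_of_eventuallyEq (constExtend_eventuallyEq_const ha hconst hx)
  · have hx0 : 0 < x := ha.trans_le hx
    refine (hsmooth.contDiffAt (Ici_mem_nhds hx0)).congr_of_eventuallyEq ?_
    filter_upwards [Ioi_mem_nhds hx0] with y hy
    exact constExtend_of_nonneg g (le_of_lt hy)

theorem bounded_iteratedDeriv_constExtend {κ : ℕ} (hg : IsFilter g)
    (hsmooth : ContDiffOn ℝ (κ : WithTop ℕ∞) g (Set.Ici 0))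
    (ha : 0 < a) (hconst : ∀ t ∈ Set.Icc 0 a, g t = g 0) {i : ℕ} (hi : i ≤ κ) :
    ∃ C, ∀ x, |iteratedDeriv i (constExtend g) x| ≤ C := by
  have hcont : Continuous (iteratedDeriv i (constExtend g)) :=
    (contDiff_constExtend hsmooth ha hconst).continuous_iteratedDeriv i (by exact_mod_cast hi)
  obtain ⟨C, hC⟩ := isCompact_Icc.exists_bound_of_continuousOn (s := Set.Icc (0 : ℝ) 2)
    hcont.continuousOn
  have hC0 : 0 ≤ C := (norm_nonneg _).trans (hC 0 (by simp))
  refine ⟨C + |g 0|, fun x => ?_⟩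
  have h0 := abs_nonneg (g 0)
  rcases lt_or_ge x 0 with hx | hx
  · rw [(constExtend_eventuallyEq_const ha hconst (hx.trans ha)).iteratedDeriv_eq i,
      iteratedDeriv_const]
    split_ifs
    · linarith
    · rw [abs_zero]; positivity
  rcases lt_or_ge 2 x with hx2 | hx2
  · rw [(constExtend_eventuallyEq_zero hg hx2).iteratedDeriv_eq i, iteratedDeriv_const]
    simp only [ite_self, abs_zero]
    positivity
  · have := hC x ⟨hx, hx2⟩
    rw [Real.norm_eq_abs] at this
    linarith

end Extension

/-- `diffOp` kills constants and looks one index to each side, so the range shrinks by one per step.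
This handles small indices, where `1/(2n+d-1)` gives no decay. The first conclusion also covers `m =
0`, needed when `κ = 1`. -/
theorem iterate_diffOp_of_locally_const (d : ℕ) {h : ℕ → ℝ} {K : ℝ}
    (hK : ∀ n : ℕ, (n : ℝ) + 1 ≤ K → h (n + 1) = h n) (m : ℕ) :
    (∀ n : ℕ, (n : ℝ) + 1 + m ≤ K → (diffOp d)^[m] h (n + 1) = (diffOp d)^[m] h n)
      ∧ (1 ≤ m → ∀ n : ℕ, (n : ℝ) + m ≤ K → (diffOp d)^[m] h n = 0) := by
  induction m with
  | zero => exact ⟨fun n hn => hK n (by simpa using hn), by simp⟩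
  | succ m ih =>
    have key : ∀ n : ℕ, (n : ℝ) + (m + 1 : ℕ) ≤ K → (diffOp d)^[m + 1] h n = 0 := by
      intro n hn
      push_cast at hn
      rw [Function.iterate_succ_apply', diffOp, ih.1 n (by linarith)]
      cases n with
      | zero => simp
      | succ n =>
        push_cast at hn
        rw [Nat.add_sub_cancel, ih.1 n (by linarith)]
        simp
    refine ⟨fun n hn => ?_, fun _ => key⟩
    rw [key n (by linarith), key (n + 1) (by push_cast at hn ⊢; linarith)]

/-! ### Kernel estimates -/

section Kernel

variable {g : ℝ → ℝ} {a : ℝ} {d κ : ℕ}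

theorem filteredKernel_eq_gegenbauerSeries (d : ℕ) (g : ℝ → ℝ) {T : ℝ} (hT : 1 ≤ T) (t : ℝ) :
    filteredKernel d g T t = gegenbauerSeries d (fun n => constExtend g (n / T)) t := by
  rw [filteredKernel, if_neg hT.not_gt, gegenbauerSeries]
  congr 1
  ext n
  rw [constExtend_of_nonneg g (by positivity)]

theorem sample_eq_zero (hg : IsFilter g) {T : ℝ} (hT : 1 ≤ T) (n : ℕ)
    (hn : ⌊2 * T⌋₊ + 1 ≤ n) : constExtend g (n / T) = 0 := by
  have hT0 : 0 < T := by linarith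
  have h1 : 2 * T < n := (Nat.lt_floor_add_one _).trans_le (by exact_mod_cast hn)
  rw [constExtend_of_nonneg g (by positivity)]
  exact hg.eq_zero _ ((lt_div_iff₀ hT0).2 h1)

theorem support_length_le {T : ℝ} (hT : 1 ≤ T) (d m : ℕ) :
    ((⌊2 * T⌋₊ + 1 + m : ℕ) : ℝ) + d ≤ (3 + m + d) * T := by
  have h1 : ((⌊2 * T⌋₊ : ℕ) : ℝ) ≤ 2 * T := Nat.floor_le (by linarith)
  have h2 : (m : ℝ) ≤ m * T := le_mul_of_one_le_right m.cast_nonneg hT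
  have h3 : (d : ℝ) ≤ d * T := le_mul_of_one_le_right d.cast_nonneg hT
  push_cast
  linarith

theorem abs_filteredKernel_le (hd : 2 ≤ d) (hg : IsFilter g)
    (hsmooth : ContDiffOn ℝ (κ : WithTop ℕ∞) g (Set.Ici 0))
    (ha : 0 < a) (hconst : ∀ t ∈ Set.Icc 0 a, g t = g 0) :
    ∃ C, 0 ≤ C ∧ ∀ T : ℝ, 1 ≤ T → ∀ t ∈ Set.Icc (-1 : ℝ) 1,
      |filteredKernel d g T t| ≤ C * T ^ d := by
  obtain ⟨B, hB⟩ := bounded_iteratedDeriv_constExtend hg hsmooth ha hconst (Nat.zero_le κ)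
  simp only [iteratedDeriv_zero] at hB
  have hB0 : 0 ≤ B := (abs_nonneg _).trans (hB 0)
  refine ⟨2 * B * (3 + d) ^ d, by positivity, fun T hT t ht => ?_⟩
  rw [filteredKernel_eq_gegenbauerSeries d g hT]
  refine (abs_gegenbauerSeries_le hd (sample_eq_zero hg hT) (fun n => hB _) ht).trans ?_
  rw [mul_assoc _ _ (T ^ d), ← mul_pow]
  have := support_length_le hT d 0
  push_cast at this ⊢
  gcongr
  linarith

theorem symbolBounded_sample (hg : IsFilter g)
    (hsmooth : ContDiffOn ℝ (κ : WithTop ℕ∞) g (Set.Ici 0))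
    (ha : 0 < a) (hconst : ∀ t ∈ Set.Icc 0 a, g t = g 0) (ε : ℝ) :
    SymbolBounded ε κ 0 0 (fun T n => constExtend g (n / T)) := by
  refine SymbolBounded.sample (F := fun _ => constExtend g) ε 0
    (fun _ => contDiff_constExtend hsmooth ha hconst) fun i hi => ?_
  obtain ⟨C, hC⟩ := bounded_iteratedDeriv_constExtend hg hsmooth ha hconst hi
  exact ⟨C, fun T _ x => by simpa using hC x⟩

theorem sample_locally_const (hconst : ∀ t ∈ Set.Icc 0 a, g t = g 0) {T : ℝ} (hT : 1 ≤ T)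
    (n : ℕ) (hn : (n : ℝ) + 1 ≤ a * T) :
    constExtend g ((n + 1 : ℕ) / T) = constExtend g (n / T) := by
  have hT0 : 0 < T := by linarith
  have h0 : (0 : ℝ) ≤ n := n.cast_nonneg
  have key : ∀ k : ℕ, (k : ℝ) ≤ a * T → constExtend g (k / T) = g 0 := fun k hk => by
    rw [constExtend_of_nonneg g (by positivity)]
    exact hconst _ ⟨by positivity, (div_le_iff₀ hT0).2 hk⟩
  rw [key n (by linarith), key (n + 1) (by push_cast; exact hn)]

theorem abs_iterate_diffOp_sample_le (hd : 2 ≤ d) (hg : IsFilter g)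
    (hsmooth : ContDiffOn ℝ (κ : WithTop ℕ∞) g (Set.Ici 0))
    (ha : 0 < a) (hconst : ∀ t ∈ Set.Icc 0 a, g t = g 0) {m : ℕ} (hm : 1 ≤ m)
    (hmκ : 2 * m ≤ κ) :
    ∃ C, 0 ≤ C ∧ ∀ T : ℝ, 1 ≤ T → (4 * m + 4) / a ≤ T → ∀ n : ℕ,
      |(diffOp d)^[m] (fun n => constExtend g (n / T)) n| ≤ C / T ^ (2 * m) := by
  have hS := symbolBounded_sample hg hsmooth ha hconst (a / 2)
  obtain ⟨C, hC⟩ := (SymbolBounded.iterate_diffOp (j := 0) (half_pos ha) hd m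
    (hS.of_le (by omega))).bound
  refine ⟨|C|, abs_nonneg _, fun T hT hT' n => ?_⟩
  have hT0 : 0 < T := by linarith
  rcases le_or_gt (a / 2 * T + m) n with hn | hn
  · exact (hC T hT n hn).trans (by gcongr; exact le_abs_self C)
  -- The threshold gives `a T ≥ 4m + 4`, hence `n + m < (a/2) T + 2m ≤ a T`, inside the range of
  -- constancy.
  · rw [div_le_iff₀ ha] at hT'
    rw [(iterate_diffOp_of_locally_const d (K := a * T)
      (sample_locally_const hconst hT) m).2 hm n (by linarith), abs_zero]
    positivity

theorem abs_sub_iterate_diffOp_sample_le (hd : 2 ≤ d) (hg : IsFilter g)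
    (hsmooth : ContDiffOn ℝ (κ : WithTop ℕ∞) g (Set.Ici 0))
    (ha : 0 < a) (hconst : ∀ t ∈ Set.Icc 0 a, g t = g 0) {m : ℕ}
    (hmκ : 2 * m + 1 ≤ κ) :
    ∃ C, 0 ≤ C ∧ ∀ T : ℝ, 1 ≤ T → (4 * m + 4) / a ≤ T → ∀ n : ℕ,
      |(diffOp d)^[m] (fun n => constExtend g (n / T)) (n + 1)
        - (diffOp d)^[m] (fun n => constExtend g (n / T)) n| ≤ C / T ^ (2 * m + 1) := by
  have hS := symbolBounded_sample hg hsmooth ha hconst (a / 2)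
  obtain ⟨C, hC⟩ := (SymbolBounded.iterate_diffOp (j := 1) (half_pos ha) hd m
    (hS.of_le (by omega))).2.bound
  refine ⟨|C|, abs_nonneg _, fun T hT hT' n => ?_⟩
  have hT0 : 0 < T := by linarith
  rcases le_or_gt (a / 2 * T + m) n with hn | hn
  · exact (hC T hT n hn).trans (by gcongr; exact le_abs_self C)
  · rw [div_le_iff₀ ha] at hT'
    rw [(iterate_diffOp_of_locally_const d (K := a * T)
      (sample_locally_const hconst hT) m).1 n (by linarith), sub_self, abs_zero]
    positivity

theorem sq_le_mul_one_sub_cos {θ : ℝ} (hθ : θ ∈ Set.Icc 0 Real.pi) :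
    θ ^ 2 ≤ Real.pi ^ 2 / 2 * (1 - Real.cos θ) := by
  have h := Real.cos_le_one_sub_mul_cos_sq (x := θ) (by rw [abs_of_nonneg hθ.1]; exact hθ.2)
  have hpi := Real.pi_pos
  have h1 : 2 / Real.pi ^ 2 * θ ^ 2 ≤ 1 - Real.cos θ := by linarith
  calc θ ^ 2 = Real.pi ^ 2 / 2 * (2 / Real.pi ^ 2 * θ ^ 2) := by field_simp
    _ ≤ _ := by gcongr

theorem mul_pow_abs_filteredKernel_le_of_even (hd : 2 ≤ d) (hg : IsFilter g)
    (hsmooth : ContDiffOn ℝ (κ : WithTop ℕ∞) g (Set.Ici 0))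
    (ha : 0 < a) (hconst : ∀ t ∈ Set.Icc 0 a, g t = g 0) {m : ℕ} (hm : 1 ≤ m)
    (hmκ : 2 * m ≤ κ) :
    ∃ C, 0 ≤ C ∧ ∀ T : ℝ, 1 ≤ T → (4 * m + 4) / a ≤ T → ∀ θ ∈ Set.Icc 0 Real.pi,
      (T * θ) ^ (2 * m) * |filteredKernel d g T (Real.cos θ)| ≤ C * T ^ d := by
  obtain ⟨C, hC0, hC⟩ := abs_iterate_diffOp_sample_le hd hg hsmooth ha hconst hm hmκ
  refine ⟨(Real.pi ^ 2 / 2) ^ m * (2 * C * (3 + m + d) ^ d), by positivity,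
    fun T hT hT' θ hθ => ?_⟩
  have hT0 : 0 < T := by linarith
  have hit := gegenbauerSeries_iterate_diffOp hd m (sample_eq_zero hg hT) (Real.cos θ)
  have hb := abs_gegenbauerSeries_le hd hit.2 (hC T hT hT') (Real.cos_mem_Icc θ)
  have hcos : 0 ≤ 1 - Real.cos θ := by linarith [Real.cos_le_one θ]
  rw [hit.1, ← filteredKernel_eq_gegenbauerSeries d g hT, abs_mul,
    abs_of_nonneg (pow_nonneg hcos m)] at hb
  have hθm : θ ^ (2 * m) ≤ (Real.pi ^ 2 / 2) ^ m * (1 - Real.cos θ) ^ m := by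
    rw [pow_mul, ← mul_pow]
    exact pow_le_pow_left₀ (sq_nonneg _) (sq_le_mul_one_sub_cos hθ) m
  calc (T * θ) ^ (2 * m) * |filteredKernel d g T (Real.cos θ)|
      = T ^ (2 * m) * (θ ^ (2 * m) * |filteredKernel d g T (Real.cos θ)|) := by
        rw [mul_pow]; ring
    _ ≤ T ^ (2 * m) * ((Real.pi ^ 2 / 2) ^ m * (1 - Real.cos θ) ^ m
          * |filteredKernel d g T (Real.cos θ)|) := by gcongr
    _ = T ^ (2 * m) * ((Real.pi ^ 2 / 2) ^ m * ((1 - Real.cos θ) ^ m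
          * |filteredKernel d g T (Real.cos θ)|)) := by ring
    _ ≤ T ^ (2 * m) * ((Real.pi ^ 2 / 2) ^ m
          * (2 * (C / T ^ (2 * m)) * ((3 + m + d) * T) ^ d)) := by
        have h3 : 2 * (C / T ^ (2 * m)) * (((⌊2 * T⌋₊ + 1 + m : ℕ) : ℝ) + d) ^ d
            ≤ 2 * (C / T ^ (2 * m)) * ((3 + m + d) * T) ^ d := by
          gcongr
          exact support_length_le hT d m
        have := hb.trans h3
        gcongr
    _ = _ := by rw [mul_pow]; field_simp

theorem mul_pow_abs_filteredKernel_le_of_odd (hd : 2 ≤ d) (hg : IsFilter g)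
    (hsmooth : ContDiffOn ℝ (κ : WithTop ℕ∞) g (Set.Ici 0))
    (ha : 0 < a) (hconst : ∀ t ∈ Set.Icc 0 a, g t = g 0) {m : ℕ}
    (hmκ : 2 * m + 1 ≤ κ) :
    ∃ C, 0 ≤ C ∧ ∀ T : ℝ, 1 ≤ T → (4 * m + 4) / a ≤ T → ∀ θ ∈ Set.Icc 0 Real.pi,
      (T * θ) ^ (2 * m + 1) * |filteredKernel d g T (Real.cos θ)| ≤ C * T ^ d := by
  obtain ⟨C, hC0, hC⟩ := abs_sub_iterate_diffOp_sample_le hd hg hsmooth ha hconst hmκ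
  refine ⟨(Real.pi ^ 2 / 2) ^ (m + 1) * (3 * C * (3 + m + d) ^ d), by positivity,
    fun T hT hT' θ hθ => ?_⟩
  have hT0 : 0 < T := by linarith
  rcases hθ.1.eq_or_lt with h0 | hθ0
  · rw [← h0, mul_zero, zero_pow (by omega), zero_mul]
    positivity
  have hit := gegenbauerSeries_iterate_diffOp hd m (sample_eq_zero hg hT) (Real.cos θ)
  have hb := abs_one_sub_mul_gegenbauerSeries_le hd hit.2 (hC T hT hT') hθ
  have hcos : 0 ≤ 1 - Real.cos θ := by linarith [Real.cos_le_one θ]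
  rw [hit.1, ← filteredKernel_eq_gegenbauerSeries d g hT, ← mul_assoc, ← pow_succ', abs_mul,
    abs_of_nonneg (pow_nonneg hcos (m + 1))] at hb
  have hθm : θ ^ (2 * (m + 1))
      ≤ (Real.pi ^ 2 / 2) ^ (m + 1) * (1 - Real.cos θ) ^ (m + 1) := by
    rw [pow_mul, ← mul_pow]
    exact pow_le_pow_left₀ (sq_nonneg _) (sq_le_mul_one_sub_cos hθ) (m + 1)
  -- The even power `θ^(2m+2)` matches `(1 - cos θ)^(m+1)`; the surplus `θ` cancels the one coming
  -- from `|P_n - P_{n+1}| ≤ 3θ`.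
  refine le_of_mul_le_mul_left ?_ hθ0
  calc θ * ((T * θ) ^ (2 * m + 1) * |filteredKernel d g T (Real.cos θ)|)
      = T ^ (2 * m + 1) * (θ ^ (2 * (m + 1)) * |filteredKernel d g T (Real.cos θ)|) := by
        rw [mul_pow]; ring
    _ ≤ T ^ (2 * m + 1) * ((Real.pi ^ 2 / 2) ^ (m + 1) * (1 - Real.cos θ) ^ (m + 1)
          * |filteredKernel d g T (Real.cos θ)|) := by gcongr
    _ = T ^ (2 * m + 1) * ((Real.pi ^ 2 / 2) ^ (m + 1) * ((1 - Real.cos θ) ^ (m + 1)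
          * |filteredKernel d g T (Real.cos θ)|)) := by ring
    _ ≤ T ^ (2 * m + 1) * ((Real.pi ^ 2 / 2) ^ (m + 1)
          * (3 * θ * (C / T ^ (2 * m + 1)) * ((3 + m + d) * T) ^ d)) := by
        have h3 : 3 * θ * (C / T ^ (2 * m + 1)) * (((⌊2 * T⌋₊ + 1 + m : ℕ) : ℝ) + d) ^ d
            ≤ 3 * θ * (C / T ^ (2 * m + 1)) * ((3 + m + d) * T) ^ d := by
          gcongr
          exact support_length_le hT d m
        have := hb.trans h3
        gcongr
    _ = _ := by rw [mul_pow]; field_simp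

theorem exists_mul_pow_abs_filteredKernel_le (hd : 2 ≤ d) (hκ : 1 ≤ κ) (hg : IsFilter g)
    (hsmooth : ContDiffOn ℝ (κ : WithTop ℕ∞) g (Set.Ici 0))
    (ha : 0 < a) (hconst : ∀ t ∈ Set.Icc 0 a, g t = g 0) :
    ∃ C T₀ : ℝ, 0 ≤ C ∧ 0 ≤ T₀ ∧ ∀ T : ℝ, 1 ≤ T → T₀ ≤ T → ∀ θ ∈ Set.Icc 0 Real.pi,
      (T * θ) ^ κ * |filteredKernel d g T (Real.cos θ)| ≤ C * T ^ d := by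
  rcases Nat.even_or_odd' κ with ⟨m, hm | hm⟩
  · obtain ⟨C, hC0, hC⟩ := mul_pow_abs_filteredKernel_le_of_even hd hg hsmooth ha hconst
      (m := m) (by omega) hm.ge
    exact ⟨C, (4 * m + 4) / a, hC0, by positivity, hm ▸ hC⟩
  · obtain ⟨C, hC0, hC⟩ := mul_pow_abs_filteredKernel_le_of_odd hd hg hsmooth ha hconst
      (m := m) hm.ge
    exact ⟨C, (4 * m + 4) / a, hC0, by positivity, hm ▸ hC⟩

end Kernel

end SphericalFilter

/-- Localisation of the filtered kernel on the sphere `S^d`. -/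
theorem mainTheorem12 (d : ℕ) (hd : 2 ≤ d) (κ : ℕ) (hκ : 1 ≤ κ)
    (g : ℝ → ℝ) (hg : SphericalFilter.IsFilter g)
    (hsmooth : ContDiffOn ℝ (κ : WithTop ℕ∞) g (Set.Ici 0))
    (hconst : ∃ a : ℝ, 0 < a ∧ a < 2 ∧ ∀ t ∈ Set.Icc 0 a, g t = g 0) :
    ∃ c : ℝ, ∀ T : ℝ, 1 ≤ T →
      ∀ x ∈ Metric.sphere (0 : EuclideanSpace ℝ (Fin (d + 1))) 1,
      ∀ y ∈ Metric.sphere (0 : EuclideanSpace ℝ (Fin (d + 1))) 1,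
      ∀ θ ∈ Set.Icc 0 Real.pi, Real.cos θ = inner ℝ x y →
        |SphericalFilter.filteredKernel d g T (Real.cos θ)| ≤ c * T ^ d / (1 + T * θ) ^ κ := by
  obtain ⟨a, ha, -, hconst⟩ := hconst
  obtain ⟨C₁, hC₁, h₁⟩ := SphericalFilter.abs_filteredKernel_le hd hg hsmooth ha hconst
  obtain ⟨C₂, T₀, hC₂, hT₀, h₂⟩ :=
    SphericalFilter.exists_mul_pow_abs_filteredKernel_le hd hκ hg hsmooth ha hconst
  -- From `(1 + X)^κ ≤ 2^(κ-1) (1 + X^κ)` with `X = T θ`. `C₁` controls the term `1`, `C₂` controls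
  -- `X^κ` for `T ≥ T₀`; for `T ≤ T₀`, `X ≤ T₀ π` and the trivial bound suffices.
  refine ⟨2 ^ (κ - 1) * (C₁ + (C₂ + (T₀ * Real.pi) ^ κ * C₁)), ?_⟩
  intro T hT _ _ _ _ θ hθ _
  have hT0 : 0 < T := by linarith
  have hθ0 := hθ.1
  have hpi := Real.pi_pos
  have hX : 0 ≤ T * θ := by positivity
  set V := |SphericalFilter.filteredKernel d g T (Real.cos θ)| with hV
  have hV1 : V ≤ C₁ * T ^ d := h₁ T hT _ (Real.cos_mem_Icc θ)
  have hV2 : (T * θ) ^ κ * V ≤ (C₂ + (T₀ * Real.pi) ^ κ * C₁) * T ^ d := by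
    rcases le_total T₀ T with h | h
    · have := h₂ T hT h θ hθ
      have h3 : 0 ≤ (T₀ * Real.pi) ^ κ * C₁ * T ^ d := by positivity
      linarith
    · have h3 : (T * θ) ^ κ * V ≤ (T₀ * Real.pi) ^ κ * (C₁ * T ^ d) := by
        have := hθ.2
        gcongr
      have h4 : 0 ≤ C₂ * T ^ d := by positivity
      linarith
  rw [le_div_iff₀ (by positivity)]
  calc V * (1 + T * θ) ^ κ ≤ V * (2 ^ (κ - 1) * (1 ^ κ + (T * θ) ^ κ)) := by
        gcongr
        exact add_pow_le zero_le_one hX κ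
    _ = 2 ^ (κ - 1) * (V + (T * θ) ^ κ * V) := by rw [one_pow]; ring
    _ ≤ 2 ^ (κ - 1) * (C₁ * T ^ d + (C₂ + (T₀ * Real.pi) ^ κ * C₁) * T ^ d) := by gcongr
    _ = _ := by ring
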